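/- Let $n\ge 2$, let $m_1,\dots,m_n>0$ be masses at positions $z_1,\dots,z_n\in\mathbb{C}$, let $\gamma\in\mathbb{C}$ with $|\gamma|\ne 1$, and put $R(z)=\overline{\gamma}z+\sum_{j=1}^n\frac{m_j}{z-z_j}$. Consider the lensing map $$\eta_n(z)=z-\gamma\overline{z}-\sum_{j=1}^n\frac{m_j}{\overline{z}-\overline{z_j}}=z-\overline{R(z)},\qquad z\in\mathbb{C}\setminus\{z_1,\dots,z_n\}.$$ For a lensing map $\eta$, an image of a source $\zeta\in\mathbb{C}$ is a solution $z$ of $\eta(z)=\zeta$ that is not a mass position, and the caustic of $\eta$ is the set of all values $\eta(z)$ at points $z$ (not mass positions) where the real Jacobian determinant of $\eta$ vanishes. An image $z$ of $\zeta$ under $\eta_n$ is called sense-preserving if $|R'(z)|<1$ and sense-reversing if $|R'(z)|>1$. Let $z_{n+1}\in\mathbb{C}$ with $z_{n+1}\ne z_j$ for $1\le j\le n$, and let $\zeta\in\mathbb{C}$ not lie on the caustic of $\eta_n$. For $m_{n+1}>0$ put $\eta_{n+1}(z)=\eta_n(z)-\frac{m_{n+1}}{\overline{z}-\overline{z_{n+1}}}$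 for $z\in\mathbb{C}\setminus\{z_1,\dots,z_{n+1}\}$. Then for all sufficiently small $m_{n+1}>0$ for which $\zeta$ does not lie on the caustic of $\eta_{n+1}$, there is an open disk $D$ centered at $z_{n+1}$ such that $D\setminus\{z_{n+1}\}$ contains none of $z_1,\dots,z_n$ and no image of $\zeta$ under $\eta_n$, such that $\eta_n$ and $\eta_{n+1}$ have the same (finite) number of images of $\zeta$ outside $D$, and such that the following holds: 1. If $z_{n+1}$ is not an image of $\zeta$ under $\eta_n$, then $\eta_{n+1}$ has at least one image of $\zeta$ in $D$. 2. If $z_{n+1}$ is a sense-reversing image of $\zeta$ under $\eta_n$, then $\eta_{n+1}$ has at least two images of $\zeta$ in $D$. 3. If $z_{n+1}$ is a sense-preserving image of $\zeta$ under $\eta_n$ and $R'(z_{n+1})\ne 0$, then $\eta_{n+1}$ has at least four images of $\zeta$ in $D$. 4. If $z_{n+1}$ is a sense-preserving image of $\zeta$ under $\eta_n$ and, for some integer $d\ge 2$, $R'(z_{n+1})=\dots=R^{(d-2)}(z_{n+1})=0$ and $R^{(d-1)}(z_{n+1})\ne 0$, then $\eta_{n+1}$ has at least $2d$ images of $\zeta$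 in $D$. -/

import Mathlib

open scoped ComplexConjugate

namespace PointLens

variable {n : ℕ}

/-- The rational function `R(w) = conj γ * w + ∑ⱼ mⱼ / (w - zⱼ)` of the lens with shear `γ`
and masses `mⱼ` at the positions `zⱼ`. -/
noncomputable def deflection (γ : ℂ) (m : Fin n → ℝ) (z : Fin n → ℂ) (w : ℂ) : ℂ :=
  conj γ * w + ∑ j, (m j : ℂ) / (w - z j)

/-- The lensing map `η(w) = w - γ * conj w - ∑ⱼ mⱼ / (conj w - conj zⱼ)`.
It is meant on `lensPlane z` only. -/
noncomputable def lensMap (γ : ℂ) (m : Fin n → ℝ) (z : Fin n → ℂ) (w : ℂ) : ℂ :=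
  w - γ * conj w - ∑ j, (m j : ℂ) / (conj w - conj (z j))

/-- The lens plane: the complex plane without the mass positions. -/
def lensPlane (z : Fin n → ℂ) : Set ℂ := {w | ∀ j, w ≠ z j}

/-- The images of the source `ζ`: the solutions of `η(w) = ζ` in the lens plane. -/
def images (γ : ℂ) (m : Fin n → ℝ) (z : Fin n → ℂ) (ζ : ℂ) : Set ℂ :=
  {w | w ∈ lensPlane z ∧ lensMap γ m z w = ζ}

/-- The critical set: the points of the lens plane at which the functional determinant of the
lensing map, as a map of the real plane, vanishes. -/
def criticalSet (γ : ℂ) (m : Fin n → ℝ) (z : Fin n → ℂ) : Set ℂ :=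
  {w | w ∈ lensPlane z ∧ (fderiv ℝ (lensMap γ m z) w).det = 0}

/-- The caustic: the points of the source plane that have an image in the critical set. -/
def caustic (γ : ℂ) (m : Fin n → ℝ) (z : Fin n → ℂ) : Set ℂ :=
  lensMap γ m z '' criticalSet γ m z

/-- `w` is a sense-preserving image of `ζ`. -/
def IsSensePreservingImage (γ : ℂ) (m : Fin n → ℝ) (z : Fin n → ℂ) (ζ w : ℂ) : Prop :=
  w ∈ images γ m z ζ ∧ ‖deriv (deflection γ m z) w‖ < 1

/-- `w` is a sense-reversing image of `ζ`. -/
def IsSenseReversingImage (γ : ℂ) (m : Fin n → ℝ) (z : Fin n → ℂ) (ζ w : ℂ) : Prop :=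
  w ∈ images γ m z ζ ∧ 1 < ‖deriv (deflection γ m z) w‖

/-- The masses `m₁, …, mₙ, μ`. -/
def addMass (m : Fin n → ℝ) (μ : ℝ) : Fin (n + 1) → ℝ := Fin.snoc m μ

/-- The positions `z₁, …, zₙ, p`. -/
def addPosition (z : Fin n → ℂ) (p : ℂ) : Fin (n + 1) → ℂ := Fin.snoc z p

end PointLens

namespace PointLens

/-! Images are continued from added mass zero by the inverse function theorem. Since `ζ` is off the
caustic of the original lens, each of its images is a nondegenerate zero of `η - ζ`. An image away
from `p` thus has exactly one nearby continuation (`exists_nhds_unique_image`,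
`eventually_exists_image`). No others occur outside the disk: `‖η - ζ‖` exceeds 1 near the masses
and, as `‖γ‖ ≠ 1`, near infinity. By compactness it is bounded below off the old images, while the
new term is at most `μ / r`. This gives `eventually_encard_images_diff_ball`.

If `p` is not an image, the equation `(η(w) - ζ)(conj w - conj p) = μ` has the nondegenerate
solution `w = p` at `μ = 0`, which continues to `μ > 0`.

If `p` is an image, write `R(w) - R(p) = (w - p)^(e+1) q(w)` with `q(p) ≠ 0`, `μ = t²` and `w = p +
t v`. Conjugating and multiplying by `v / t` gives `|v|² - 1 = t^e g` with `g = v^(e+2) q(p + t v)`.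
For `e > 0` its limit `|v| = 1` is a whole circle. But `g` must be real, so `Im g = 0` may replace
the imaginary part `t^e Im g = 0`. The resulting system is nondegenerate at `t = 0`. Its limit has
`2(e+2)` solutions if `e > 0`; if `e = 0`, it has four for `|q(p)| < 1` and two for `|q(p)| > 1`.
Each continues to a distinct image; here `d = e + 2`. -/

open Filter Topology

/-! ### Continuation of zeros in a real parameter -/

/-- The map `x ↦ (x.1, H x)` has invertible derivative. -/
theorem exists_equiv_hasStrictFDerivAt_fst_prod {H : ℝ × ℂ → ℂ} {v₀ : ℂ}
    {L : ℂ →L[ℝ] ℂ} (hH : ContDiffAt ℝ 1 H (0, v₀))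
    (hL : HasFDerivAt (fun v => H (0, v)) L v₀) (hinj : ∀ w, L w = 0 → w = 0) :
    ∃ e : (ℝ × ℂ) ≃L[ℝ] (ℝ × ℂ),
      HasStrictFDerivAt (fun x : ℝ × ℂ => (x.1, H x)) (e : (ℝ × ℂ) →L[ℝ] (ℝ × ℂ)) (0, v₀) := by
  have h1 : HasStrictFDerivAt H (fderiv ℝ H (0, v₀)) (0, v₀) :=
    hH.hasStrictFDerivAt (by norm_num)
  have h2 : HasStrictFDerivAt (fun x : ℝ × ℂ => (x.1, H x))
      ((ContinuousLinearMap.fst ℝ ℝ ℂ).prod (fderiv ℝ H (0, v₀))) (0, v₀) :=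
    hasStrictFDerivAt_fst.prodMk h1
  have h3 : L = (fderiv ℝ H (0, v₀)).comp (ContinuousLinearMap.inr ℝ ℝ ℂ) :=
    hL.unique (HasFDerivAt.comp v₀ h1.hasFDerivAt (hasFDerivAt_prodMk_right (0 : ℝ) v₀))
  have h4 : Function.Injective
      ((ContinuousLinearMap.fst ℝ ℝ ℂ).prod (fderiv ℝ H (0, v₀)) : ℝ × ℂ →ₗ[ℝ] ℝ × ℂ) := by
    rw [injective_iff_map_eq_zero]
    rintro ⟨s, w⟩ h
    have hs : s = 0 := congrArg Prod.fst h
    have hw : fderiv ℝ H (0, v₀) (s, w) = 0 := congrArg Prod.snd h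
    subst hs
    have : w = 0 := hinj w (by rw [h3]; exact hw)
    simp [this]
  refine ⟨(LinearEquiv.ofInjectiveEndo _ h4).toContinuousLinearEquiv, ?_⟩
  convert h2 using 1
  exact ContinuousLinearMap.ext fun _ => rfl

/-- The map `x ↦ (x.1, H x)` is open at `(0, v₀)`, so it attains `(t, 0)` for small `t`; the first
coordinate identifies the parameter. -/
theorem eventually_exists_zero {H : ℝ × ℂ → ℂ} {v₀ : ℂ} {L : ℂ →L[ℝ] ℂ}
    (hH : ContDiffAt ℝ 1 H (0, v₀)) (h0 : H (0, v₀) = 0)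
    (hL : HasFDerivAt (fun v => H (0, v)) L v₀) (hinj : ∀ w, L w = 0 → w = 0)
    {U : Set ℂ} (hU : U ∈ 𝓝 v₀) :
    ∀ᶠ t in 𝓝 (0 : ℝ), ∃ v ∈ U, H (t, v) = 0 := by
  obtain ⟨e, he⟩ := exists_equiv_hasStrictFDerivAt_fst_prod hH hL hinj
  have h1 := he.map_nhds_eq_of_equiv
  have h2 : (Set.univ : Set ℝ) ×ˢ U ∈ 𝓝 ((0 : ℝ), v₀) := prod_mem_nhds univ_mem hU
  have h3 := image_mem_map (m := fun x : ℝ × ℂ => (x.1, H x)) h2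
  rw [h1, h0] at h3
  have h4 : Tendsto (fun t : ℝ => (t, (0 : ℂ))) (𝓝 0) (𝓝 (0, 0)) :=
    (by fun_prop : Continuous fun t : ℝ => (t, (0 : ℂ))).tendsto' _ _ rfl
  filter_upwards [h4 h3] with t ht
  obtain ⟨⟨s, v⟩, ⟨-, hv⟩, h⟩ := ht
  obtain ⟨hs, h⟩ := Prod.mk.inj h
  exact ⟨v, hv, by rw [← hs]; exact h⟩

theorem exists_nhds_zero_unique {H : ℝ × ℂ → ℂ} {v₀ : ℂ} {L : ℂ →L[ℝ] ℂ}
    (hH : ContDiffAt ℝ 1 H (0, v₀))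
    (hL : HasFDerivAt (fun v => H (0, v)) L v₀) (hinj : ∀ w, L w = 0 → w = 0) :
    ∃ U ∈ 𝓝 v₀, ∀ᶠ t in 𝓝 (0 : ℝ), ∀ v ∈ U, ∀ v' ∈ U, H (t, v) = 0 → H (t, v') = 0 → v = v' := by
  obtain ⟨e, he⟩ := exists_equiv_hasStrictFDerivAt_fst_prod hH hL hinj
  have h1 := (he.toOpenPartialHomeomorph _).open_source.mem_nhds
    he.mem_toOpenPartialHomeomorph_source
  obtain ⟨V, hV, U, hU, hVU⟩ := mem_nhds_prod_iff.1 h1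
  refine ⟨U, hU, ?_⟩
  filter_upwards [hV] with t ht v hv v' hv' h h'
  have := (he.toOpenPartialHomeomorph _).injOn (hVU (Set.mk_mem_prod ht hv))
    (hVU (Set.mk_mem_prod ht hv')) (by simp [h, h'])
  exact (Prod.mk.inj this).2

/-! ### The lens map and the equation with an added mass -/

theorem isOpen_lensPlane {n : ℕ} (z : Fin n → ℂ) : IsOpen (lensPlane z) := by
  have : lensPlane z = ⋂ j, {z j}ᶜ := by ext w; simp [lensPlane]
  rw [this]
  exact isOpen_iInter_of_finite fun j => isOpen_compl_singleton

theorem conj_sub_conj_ne_zero {a b : ℂ} (h : a ≠ b) : conj a - conj b ≠ 0 := by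
  rw [← map_sub]
  exact (map_ne_zero _).2 (sub_ne_zero.2 h)

theorem contDiff_conj {k : WithTop ℕ∞} : ContDiff ℝ k (fun w : ℂ => conj w) :=
  Complex.conjCLE.contDiff

theorem contDiffAt_lensMap {n : ℕ} (γ : ℂ) (m : Fin n → ℝ) {z : Fin n → ℂ} {w : ℂ}
    (hw : w ∈ lensPlane z) {k : WithTop ℕ∞} : ContDiffAt ℝ k (lensMap γ m z) w := by
  unfold lensMap
  refine ((contDiffAt_id).sub (contDiffAt_const.mul contDiff_conj.contDiffAt)).sub ?_
  refine ContDiffAt.sum fun j _ => ?_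
  simp only [div_eq_mul_inv]
  exact contDiffAt_const.mul ((contDiff_conj.contDiffAt.sub contDiffAt_const).inv
    (conj_sub_conj_ne_zero (hw j)))

theorem continuousOn_lensMap {n : ℕ} (γ : ℂ) (m : Fin n → ℝ) (z : Fin n → ℂ) :
    ContinuousOn (lensMap γ m z) (lensPlane z) := fun _ hw =>
  (contDiffAt_lensMap γ m hw (k := 0)).continuousAt.continuousWithinAt

theorem lensMap_add (γ : ℂ) {n : ℕ} (m : Fin n → ℝ) (z : Fin n → ℂ) (μ : ℝ) (p w : ℂ) :
    lensMap γ (addMass m μ) (addPosition z p) w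
      = lensMap γ m z w - (μ : ℂ) / (conj w - conj p) := by
  simp [lensMap, addMass, addPosition, Fin.sum_univ_castSucc, sub_sub, add_assoc]

theorem mem_lensPlane_add {n : ℕ} {z : Fin n → ℂ} {p w : ℂ} :
    w ∈ lensPlane (addPosition z p) ↔ w ∈ lensPlane z ∧ w ≠ p := by
  simp [lensPlane, addPosition, Fin.forall_fin_succ']

theorem mem_images_add {n : ℕ} {γ : ℂ} {m : Fin n → ℝ} {z : Fin n → ℂ} {μ : ℝ} {p ζ w : ℂ} :
    w ∈ images γ (addMass m μ) (addPosition z p) ζ ↔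
      w ∈ lensPlane z ∧ w ≠ p ∧ lensMap γ m z w - (μ : ℂ) / (conj w - conj p) - ζ = 0 := by
  simp only [images, Set.mem_ofPred_eq, mem_lensPlane_add, lensMap_add, and_assoc, sub_eq_zero]

theorem fderiv_lensMap_injective {n : ℕ} {γ : ℂ} {m : Fin n → ℝ} {z : Fin n → ℂ} {ζ a : ℂ}
    (hζ : ζ ∉ caustic γ m z) (ha : a ∈ images γ m z ζ) :
    ∀ w, fderiv ℝ (lensMap γ m z) a w = 0 → w = 0 := by
  have hdet : (fderiv ℝ (lensMap γ m z) a).det ≠ 0 := fun h =>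
    hζ ⟨a, ⟨ha.1, h⟩, ha.2⟩
  intro w hw
  have := (LinearMap.equivOfDetNeZero _ hdet).injective
  exact this (by rw [map_zero]; exact hw)

/-- The equation for the images of `ζ` of the lens with an added mass, as a function of that
mass. -/
noncomputable def perturbedEquation {n : ℕ} (γ : ℂ) (m : Fin n → ℝ) (z : Fin n → ℂ) (p ζ : ℂ)
    (x : ℝ × ℂ) : ℂ :=
  lensMap γ m z x.2 - (x.1 : ℂ) / (conj x.2 - conj p) - ζ

theorem contDiffAt_perturbedEquation {n : ℕ} (γ : ℂ) (m : Fin n → ℝ) {z : Fin n → ℂ} {p a : ℂ}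
    (ζ : ℂ) (ha : a ∈ lensPlane z) (hap : a ≠ p) (t : ℝ) :
    ContDiffAt ℝ 1 (perturbedEquation γ m z p ζ) (t, a) := by
  unfold perturbedEquation
  refine (ContDiffAt.sub ?_ ?_).sub contDiffAt_const
  · exact ContDiffAt.comp (t, a) (contDiffAt_lensMap γ m ha) contDiffAt_snd
  · simp only [div_eq_mul_inv]
    refine ContDiffAt.mul ?_ (ContDiffAt.inv ?_ (conj_sub_conj_ne_zero hap))
    · exact (Complex.ofRealCLM.contDiff.comp contDiff_fst).contDiffAt
    · exact ((contDiff_conj.comp contDiff_snd).sub contDiff_const).contDiffAt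

theorem hasFDerivAt_perturbedEquation {n : ℕ} (γ : ℂ) (m : Fin n → ℝ) {z : Fin n → ℂ} {a : ℂ}
    (p ζ : ℂ) (ha : a ∈ lensPlane z) :
    HasFDerivAt (fun v => perturbedEquation γ m z p ζ (0, v)) (fderiv ℝ (lensMap γ m z) a) a := by
  simpa [perturbedEquation] using
    (((contDiffAt_lensMap γ m ha (k := 1)).differentiableAt (by norm_num)).hasFDerivAt).sub_const ζ

theorem eventually_notMem_images {n : ℕ} {γ : ℂ} {m : Fin n → ℝ} {z : Fin n → ℂ} {ζ a : ℂ}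
    (hζ : ζ ∉ caustic γ m z) (ha : a ∈ lensPlane z) :
    ∀ᶠ w in 𝓝[≠] a, w ∉ images γ m z ζ := by
  by_cases h : lensMap γ m z a = ζ
  -- At mass zero the added position is irrelevant; any `p ≠ a` keeps the equation smooth at `a`.
  · obtain ⟨p, hp⟩ := exists_ne a
    obtain ⟨U, hU, hev⟩ := exists_nhds_zero_unique
      (contDiffAt_perturbedEquation γ m ζ ha hp.symm 0)
      (hasFDerivAt_perturbedEquation γ m p ζ ha)
      (fderiv_lensMap_injective hζ ⟨ha, h⟩)
    have h0 := hev.self_of_nhds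
    filter_upwards [nhdsWithin_le_nhds hU, self_mem_nhdsWithin] with w hw hwa hwi
    refine hwa (h0 w hw a (mem_of_mem_nhds hU) ?_ ?_)
    · simp [perturbedEquation, hwi.2]
    · simp [perturbedEquation, h]
  · have : ∀ᶠ w in 𝓝 a, lensMap γ m z w ≠ ζ :=
      (contDiffAt_lensMap γ m ha (k := 0)).continuousAt.eventually_ne h
    filter_upwards [nhdsWithin_le_nhds this] with w hw hwi
    exact hw hwi.2

/-! ### Behaviour at infinity and at the masses; finiteness of images -/

theorem tendsto_conj_sub_cocompact (a : ℂ) :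
    Tendsto (fun w : ℂ => conj w - conj a) (cocompact ℂ) (cocompact ℂ) := by
  have h : (fun w : ℂ => conj w - conj a)
      = fun w => ((Homeomorph.subRight a).trans Complex.conjCLE.toHomeomorph) w := by
    ext w; simp
  rw [h]
  exact (Homeomorph.isClosedEmbedding _).tendsto_cocompact

theorem eventually_one_lt_norm_cocompact {n : ℕ} {γ : ℂ} (hγ : ‖γ‖ ≠ 1) (m : Fin n → ℝ)
    (z : Fin n → ℂ) (ζ : ℂ) : ∀ᶠ w in cocompact ℂ, 1 < ‖lensMap γ m z w - ζ‖ := by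
  have h1 : Tendsto (fun w : ℂ => ∑ j, (m j : ℂ) / (conj w - conj (z j))) (cocompact ℂ) (𝓝 0) := by
    rw [← Finset.sum_const_zero (ι := Fin n) (s := Finset.univ)]
    refine tendsto_finsetSum _ fun j _ => ?_
    have h := tendsto_inv₀_cobounded (α := ℂ)
    rw [Metric.cobounded_eq_cocompact] at h
    simpa [div_eq_mul_inv, Function.comp_def] using
      (h.comp (tendsto_conj_sub_cocompact (z j))).const_mul (m j : ℂ)
  have h2 : ∀ᶠ w in cocompact ℂ, ‖∑ j, (m j : ℂ) / (conj w - conj (z j))‖ < 1 := by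
    have := h1.norm
    rw [norm_zero] at this
    exact this.eventually_lt_const one_pos
  have h3 : Tendsto (fun w : ℂ => |1 - ‖γ‖| * ‖w‖) (cocompact ℂ) atTop :=
    (tendsto_norm_cocompact_atTop (E := ℂ)).const_mul_atTop
      (abs_pos.2 (sub_ne_zero.2 hγ.symm))
  filter_upwards [h2, h3.eventually_gt_atTop (2 + ‖ζ‖)] with w hw hw'
  have h4 : |1 - ‖γ‖| * ‖w‖ ≤ ‖w - γ * conj w‖ := by
    have := abs_norm_sub_norm_le w (γ * conj w)
    rw [norm_mul, Complex.norm_conj] at this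
    rwa [← one_sub_mul, abs_mul, abs_norm] at this
  set S := ∑ j, (m j : ℂ) / (conj w - conj (z j)) with hS
  have h5 : w - γ * conj w = (lensMap γ m z w - ζ) + S + ζ := by
    simp only [lensMap, hS]; ring
  have h6 := norm_add₃_le (a := lensMap γ m z w - ζ) (b := S) (c := ζ)
  rw [← h5] at h6
  linarith

/-- Multiplication by `conj w - conj a` turns the pole into the limit `-M`, with `M` the total mass
at `a`. Positions may coincide, and positivity of the masses excludes cancellation. -/
theorem eventually_one_lt_norm_nhdsNE {n : ℕ} (γ : ℂ) {m : Fin n → ℝ} (hm : ∀ j, 0 < m j)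
    (z : Fin n → ℂ) (ζ : ℂ) (i : Fin n) :
    ∀ᶠ w in 𝓝[≠] z i, 1 < ‖lensMap γ m z w - ζ‖ := by
  classical
  set a := z i
  set M : ℝ := ∑ j, if z j = a then m j else 0 with hM
  have hMpos : 0 < M := Finset.sum_pos' (fun j _ => by split_ifs <;> simp [(hm j).le])
    ⟨i, Finset.mem_univ i, by simp [a, hm i]⟩
  have hc : Continuous fun w : ℂ => conj w := Complex.continuous_conj
  have hc0 : Tendsto (fun w : ℂ => conj w - conj a) (𝓝[≠] a) (𝓝 0) :=
    ((hc.sub continuous_const).tendsto' a 0 (by simp)).mono_left nhdsWithin_le_nhds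
  have h1 : Tendsto (fun w : ℂ => ∑ j, (conj w - conj a) * ((m j : ℂ) / (conj w - conj (z j))))
      (𝓝[≠] a) (𝓝 (M : ℂ)) := by
    rw [hM, Complex.ofReal_sum]
    refine tendsto_finsetSum _ fun j _ => ?_
    by_cases h : z j = a
    · rw [if_pos h, h]
      refine tendsto_const_nhds.congr' ?_
      filter_upwards [self_mem_nhdsWithin] with w hw
      rw [mul_div_cancel₀ _ (conj_sub_conj_ne_zero hw)]
    · rw [if_neg h]
      have h2 : Tendsto (fun w : ℂ => (m j : ℂ) / (conj w - conj (z j))) (𝓝[≠] a)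
          (𝓝 ((m j : ℂ) / (conj a - conj (z j)))) :=
        (tendsto_const_nhds.div ((hc.sub continuous_const).tendsto a)
          (conj_sub_conj_ne_zero (Ne.symm h))).mono_left nhdsWithin_le_nhds
      simpa using hc0.mul h2
  have h2 : Tendsto (fun w : ℂ => (conj w - conj a) * (lensMap γ m z w - ζ)) (𝓝[≠] a)
      (𝓝 (0 * (a - γ * conj a - ζ) - M)) := by
    have h3 : Tendsto (fun w : ℂ => w - γ * conj w - ζ) (𝓝[≠] a) (𝓝 (a - γ * conj a - ζ)) :=
      ((by fun_prop : Continuous fun w : ℂ => w - γ * conj w - ζ).tendsto a).mono_left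
        nhdsWithin_le_nhds
    refine ((hc0.mul h3).sub h1).congr fun w => ?_
    rw [lensMap, ← Finset.mul_sum]
    ring
  have h3 := (hc0.norm.eventually_lt h2.norm (by simpa using hMpos.ne'))
  filter_upwards [h3, self_mem_nhdsWithin] with w hw hwa
  rw [norm_mul] at hw
  exact (lt_mul_iff_one_lt_right (norm_pos_iff.2 (conj_sub_conj_ne_zero hwa))).1 hw

theorem exists_isCompact_one_lt_norm {n : ℕ} {γ : ℂ} (hγ : ‖γ‖ ≠ 1) {m : Fin n → ℝ}
    (hm : ∀ j, 0 < m j) (z : Fin n → ℂ) (ζ : ℂ) :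
    ∃ C : Set ℂ, IsCompact C ∧ C ⊆ lensPlane z ∧
      ∀ w ∈ lensPlane z, w ∉ C → 1 < ‖lensMap γ m z w - ζ‖ := by
  obtain ⟨C₀, hC₀, h₀⟩ := mem_cocompact.1 (eventually_one_lt_norm_cocompact hγ m z ζ)
  have h1 : ∀ i, ∃ V : Set ℂ, IsOpen V ∧ z i ∈ V ∧
      ∀ w ∈ V, w ≠ z i → 1 < ‖lensMap γ m z w - ζ‖ := by
    intro i
    obtain ⟨V, hV, hVo, hz⟩ := eventually_nhds_iff.1
      (eventually_nhdsWithin_iff.1 (eventually_one_lt_norm_nhdsNE γ hm z ζ i))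
    exact ⟨V, hVo, hz, hV⟩
  choose V hVo hzV hV using h1
  refine ⟨C₀ \ ⋃ i, V i, hC₀.diff (isOpen_iUnion hVo), ?_, ?_⟩
  · rintro w ⟨-, hw⟩ j rfl
    exact hw (Set.mem_iUnion.2 ⟨j, hzV j⟩)
  · intro w hw hwC
    by_cases h : w ∈ C₀
    · obtain ⟨i, hi⟩ := Set.mem_iUnion.1 (not_not.1 fun h' => hwC ⟨h, h'⟩)
      exact hV i w hi (hw i)
    · exact h₀ h

/-- Infinitely many images in a compact part of the lens plane would accumulate there, whereas
images are isolated. -/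
theorem finite_images {n : ℕ} {γ : ℂ} (hγ : ‖γ‖ ≠ 1) {m : Fin n → ℝ} (hm : ∀ j, 0 < m j)
    {z : Fin n → ℂ} {ζ : ℂ} (hζ : ζ ∉ caustic γ m z) : (images γ m z ζ).Finite := by
  obtain ⟨C, hC, hCz, h⟩ := exists_isCompact_one_lt_norm hγ hm z ζ
  by_contra hinf
  obtain ⟨x, hx, hacc⟩ := Set.Infinite.exists_accPt_of_subset_isCompact hinf hC (by
    intro w hw
    by_contra hwC
    have := h w hw.1 hwC
    simp [hw.2] at this
    linarith)
  exact (accPt_iff_frequently_nhdsNE.1 hacc) (eventually_notMem_images hζ (hCz hx))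

/-! ### Images outside the disk -/

/-- Near an image away from `p` the lens with a small added mass at `p` has exactly one image. -/
theorem exists_nhds_unique_image {n : ℕ} {γ : ℂ} {m : Fin n → ℝ} {z : Fin n → ℂ} {p ζ a : ℂ}
    (hζ : ζ ∉ caustic γ m z) (ha : a ∈ images γ m z ζ) (hap : a ≠ p) :
    ∃ W ∈ 𝓝 a, ∀ᶠ μ in 𝓝 (0 : ℝ), ∀ v ∈ W, ∀ v' ∈ W,
      v ∈ images γ (addMass m μ) (addPosition z p) ζ →
      v' ∈ images γ (addMass m μ) (addPosition z p) ζ → v = v' := by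
  obtain ⟨U, hU, hev⟩ := exists_nhds_zero_unique
    (contDiffAt_perturbedEquation γ m ζ ha.1 hap 0)
    (hasFDerivAt_perturbedEquation γ m p ζ ha.1) (fderiv_lensMap_injective hζ ha)
  refine ⟨U, hU, ?_⟩
  filter_upwards [hev] with μ hμ v hv v' hv' h h'
  exact hμ v hv v' hv' (mem_images_add.1 h).2.2 (mem_images_add.1 h').2.2

theorem eventually_exists_image {n : ℕ} {γ : ℂ} {m : Fin n → ℝ} {z : Fin n → ℂ} {p ζ a : ℂ}
    (hζ : ζ ∉ caustic γ m z) (ha : a ∈ images γ m z ζ) (hap : a ≠ p) {V : Set ℂ}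
    (hV : V ∈ 𝓝 a) :
    ∀ᶠ μ in 𝓝 (0 : ℝ), ∃ v ∈ V, v ∈ images γ (addMass m μ) (addPosition z p) ζ := by
  have hV' : V ∩ (lensPlane z ∩ {p}ᶜ) ∈ 𝓝 a := inter_mem hV
    (((isOpen_lensPlane z).inter isOpen_compl_singleton).mem_nhds ⟨ha.1, hap⟩)
  filter_upwards [eventually_exists_zero
    (contDiffAt_perturbedEquation γ m ζ ha.1 hap 0)
    (by simp [perturbedEquation, ha.2])
    (hasFDerivAt_perturbedEquation γ m p ζ ha.1) (fderiv_lensMap_injective hζ ha) hV']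
    with μ ⟨v, hv, h⟩
  exact ⟨v, hv.1, mem_images_add.2 ⟨hv.2.1, hv.2.2, h⟩⟩

theorem eventually_encard_images_diff_ball {n : ℕ} {γ : ℂ} (hγ : ‖γ‖ ≠ 1) {m : Fin n → ℝ}
    (hm : ∀ j, 0 < m j) {z : Fin n → ℂ} {p ζ : ℂ} (hζ : ζ ∉ caustic γ m z) {r : ℝ} (hr : 0 < r)
    (hball : ∀ w ∈ Metric.closedBall p r \ {p}, w ∉ images γ m z ζ) :
    ∀ᶠ μ in 𝓝[>] (0 : ℝ),
      (images γ (addMass m μ) (addPosition z p) ζ \ Metric.ball p r).encard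
        = (images γ m z ζ \ Metric.ball p r).encard := by
  set A := images γ m z ζ \ Metric.ball p r with hA
  have hAfin : A.Finite := (finite_images hγ hm hζ).sdiff
  have hAp : ∀ a ∈ A, a ≠ p := by
    rintro a ha rfl
    exact ha.2 (Metric.mem_ball_self hr)
  have hAc : ∀ a ∈ A, a ∈ (Metric.closedBall p r)ᶜ := fun a ha h => hball a ⟨h, hAp a ha⟩ ha.1
  obtain ⟨C, hC, hCz, hCout⟩ := exists_isCompact_one_lt_norm hγ hm z ζ
  obtain ⟨U, hU, hUd⟩ := hAfin.t2_separation
  have hW : ∀ a, ∃ W, IsOpen W ∧ (a ∈ A → a ∈ W ∧ ∀ᶠ μ in 𝓝 (0 : ℝ), ∀ v ∈ W, ∀ v' ∈ W,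
      v ∈ images γ (addMass m μ) (addPosition z p) ζ →
      v' ∈ images γ (addMass m μ) (addPosition z p) ζ → v = v') := by
    intro a
    by_cases ha : a ∈ A
    · obtain ⟨W, hW, h⟩ := exists_nhds_unique_image hζ ha.1 (hAp a ha)
      refine ⟨interior W, isOpen_interior, fun _ => ⟨mem_interior_iff_mem_nhds.2 hW, ?_⟩⟩
      filter_upwards [h] with μ hμ v hv v' hv'
      exact hμ v (interior_subset hv) v' (interior_subset hv')
    · exact ⟨∅, isOpen_empty, fun h => absurd h ha⟩
  choose W hWo hW using hW
  -- Avoiding the closed disk keeps the continued images outside; `hball` rules out old images on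
  -- its boundary circle.
  let V : ℂ → Set ℂ := fun a => U a ∩ W a ∩ (Metric.closedBall p r)ᶜ
  have hVo : ∀ a, IsOpen (V a) := fun a =>
    ((hU a).2.inter (hWo a)).inter Metric.isClosed_closedBall.isOpen_compl
  have hVmem : ∀ a ∈ A, a ∈ V a := fun a ha => ⟨⟨(hU a).1, (hW a ha).1⟩, hAc a ha⟩
  have hK : IsCompact ((C \ Metric.ball p r) \ ⋃ a ∈ A, V a) :=
    (hC.diff Metric.isOpen_ball).diff (isOpen_biUnion fun a _ => hVo a)
  have hcont : ContinuousOn (fun w => ‖lensMap γ m z w - ζ‖)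
      ((C \ Metric.ball p r) \ ⋃ a ∈ A, V a) :=
    (((continuousOn_lensMap γ m z).mono fun w hw => hCz hw.1.1).sub continuousOn_const).norm
  obtain ⟨c, hc, hcK⟩ := hK.exists_forall_le' hcont (a := 0) (by
    intro w hw
    refine norm_pos_iff.2 (sub_ne_zero.2 fun h => hw.2 ?_)
    have hwA : w ∈ A := ⟨⟨hCz hw.1.1, h⟩, hw.1.2⟩
    exact Set.mem_biUnion hwA (hVmem w hwA))
  have huniq : ∀ᶠ μ in 𝓝 (0 : ℝ), ∀ a ∈ A, ∀ v ∈ W a, ∀ v' ∈ W a,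
      v ∈ images γ (addMass m μ) (addPosition z p) ζ →
      v' ∈ images γ (addMass m μ) (addPosition z p) ζ → v = v' :=
    (eventually_all_finite hAfin).2 fun a ha => (hW a ha).2
  have hex : ∀ᶠ μ in 𝓝 (0 : ℝ), ∀ a ∈ A, ∃ v ∈ V a,
      v ∈ images γ (addMass m μ) (addPosition z p) ζ :=
    (eventually_all_finite hAfin).2 fun a ha =>
      eventually_exists_image hζ ha.1 (hAp a ha) ((hVo a).mem_nhds (hVmem a ha))
  -- The bound `c` serves the compact remainder and `1` the complement of `C`.
  have hsmall : ∀ᶠ μ in 𝓝 (0 : ℝ), μ < min c 1 * r :=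
    eventually_lt_nhds (mul_pos (lt_min hc one_pos) hr)
  filter_upwards [nhdsWithin_le_nhds huniq, nhdsWithin_le_nhds hex, nhdsWithin_le_nhds hsmall,
    self_mem_nhdsWithin] with μ huniq hex hsmall hμ
  choose! g hgV hgi using hex
  have hinj : Set.InjOn g A := by
    intro a ha b hb hab
    by_contra hne
    exact Set.disjoint_left.1 (hUd ha hb hne) (hgV a ha).1.1 (hab ▸ (hgV b hb).1.1)
  have himage : images γ (addMass m μ) (addPosition z p) ζ \ Metric.ball p r = g '' A := by
    apply Set.Subset.antisymm
    · rintro w ⟨hw, hwr⟩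
      obtain ⟨hwz, hwp, hweq⟩ := mem_images_add.1 hw
      have hnorm : ‖lensMap γ m z w - ζ‖ < min c 1 := by
        have h1 : lensMap γ m z w - ζ = (μ : ℂ) / (conj w - conj p) := by
          linear_combination hweq
        have h2 : r ≤ ‖conj w - conj p‖ := by
          rw [← map_sub, Complex.norm_conj, ← dist_eq_norm]
          simpa using hwr
        rw [h1, norm_div, Complex.norm_real, Real.norm_of_nonneg (le_of_lt hμ),
          div_lt_iff₀ (hr.trans_le h2)]
        exact hsmall.trans_le (by gcongr)
      have hwC : w ∈ C := by
        by_contra h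
        exact absurd (hCout w hwz h) (not_lt.2 (hnorm.le.trans (min_le_right _ _)))
      have hwV : w ∈ ⋃ a ∈ A, V a := by
        by_contra h
        exact absurd (hcK w ⟨⟨hwC, hwr⟩, h⟩) (not_le.2 (hnorm.trans_le (min_le_left _ _)))
      obtain ⟨a, ha, hwa⟩ := Set.mem_iUnion₂.1 hwV
      exact ⟨a, ha, huniq a ha _ (hgV a ha).1.2 _ hwa.1.2 (hgi a ha) hw⟩
    · rintro _ ⟨a, ha, rfl⟩
      exact ⟨hgi a ha, fun h => (hgV a ha).2 (Metric.ball_subset_closedBall h)⟩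
  rw [himage, hinj.encard_image]

/-! ### The deflection near the added mass -/

theorem lensMap_eq_sub_conj_deflection {n : ℕ} (γ : ℂ) (m : Fin n → ℝ) (z : Fin n → ℂ) (w : ℂ) :
    lensMap γ m z w = w - conj (deflection γ m z w) := by
  simp [lensMap, deflection, sub_sub]

theorem analyticAt_deflection {n : ℕ} (γ : ℂ) (m : Fin n → ℝ) {z : Fin n → ℂ} {p : ℂ}
    (hp : p ∈ lensPlane z) : AnalyticAt ℂ (deflection γ m z) p := by
  unfold deflection
  refine (analyticAt_const.mul analyticAt_id).add ?_
  refine Finset.analyticAt_fun_sum _ fun j _ => ?_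
  exact analyticAt_const.div (analyticAt_id.sub analyticAt_const) (sub_ne_zero.2 (hp j))

theorem eventually_one_le_encard {n : ℕ} (γ : ℂ) (m : Fin n → ℝ) {z : Fin n → ℂ} {p ζ : ℂ}
    (hp : p ∈ lensPlane z) (hpi : p ∉ images γ m z ζ) {r : ℝ} (hr : 0 < r) :
    ∀ᶠ μ in 𝓝[>] (0 : ℝ),
      1 ≤ (images γ (addMass m μ) (addPosition z p) ζ ∩ Metric.ball p r).encard := by
  have hne : lensMap γ m z p - ζ ≠ 0 := sub_ne_zero.2 fun h => hpi ⟨hp, h⟩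
  let H : ℝ × ℂ → ℂ := fun x => (lensMap γ m z x.2 - ζ) * (conj x.2 - conj p) - (x.1 : ℂ)
  have hH : ContDiffAt ℝ 1 H (0, p) := by
    refine ContDiffAt.sub (ContDiffAt.mul (ContDiffAt.sub ?_ contDiffAt_const) ?_) ?_
    · exact ContDiffAt.comp ((0 : ℝ), p) (contDiffAt_lensMap γ m hp) contDiffAt_snd
    · exact ((contDiff_conj.comp contDiff_snd).sub contDiff_const).contDiffAt
    · exact (Complex.ofRealCLM.contDiff.comp contDiff_fst).contDiffAt
  have hL : HasFDerivAt (fun v => H (0, v))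
      ((lensMap γ m z p - ζ) • (Complex.conjCLE : ℂ →L[ℝ] ℂ)) p := by
    have h1 := (((contDiffAt_lensMap γ m hp (k := 1)).differentiableAt
      (by norm_num)).hasFDerivAt).sub_const ζ
    have h2 : HasFDerivAt (fun w : ℂ => conj w - conj p) (Complex.conjCLE : ℂ →L[ℝ] ℂ) p :=
      (Complex.conjCLE : ℂ →L[ℝ] ℂ).hasFDerivAt.sub_const _
    simpa [H] using h1.fun_mul h2
  have hU : lensPlane z ∩ Metric.ball p r ∈ 𝓝 p :=
    inter_mem ((isOpen_lensPlane z).mem_nhds hp) (Metric.ball_mem_nhds p hr)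
  have := eventually_exists_zero hH (by simp [H]) hL (fun w hw => by
    simpa [hne] using hw) hU
  filter_upwards [nhdsWithin_le_nhds this, self_mem_nhdsWithin] with μ ⟨w, hw, h⟩ hμ
  have hμ' : (μ : ℂ) ≠ 0 := Complex.ofReal_ne_zero.2 (ne_of_gt hμ)
  -- At `w = p` the cleared equation reads `-μ = 0`.
  have hwp : w ≠ p := by
    rintro rfl
    exact hμ' (by simpa [H] using h)
  rw [Set.one_le_encard_iff_nonempty]
  refine ⟨w, mem_images_add.2 ⟨hw.1, hwp, ?_⟩, hw.2⟩
  have h0 := conj_sub_conj_ne_zero hwp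
  simp only [H] at h
  field_simp
  linear_combination h

theorem exists_deflection_factorization {n : ℕ} (γ : ℂ) (m : Fin n → ℝ) {z : Fin n → ℂ} {p : ℂ}
    (hp : p ∈ lensPlane z) {e : ℕ}
    (h : ∀ k, 1 ≤ k → k ≤ e → iteratedDeriv k (deflection γ m z) p = 0)
    (hne : iteratedDeriv (e + 1) (deflection γ m z) p ≠ 0) :
    ∃ q : ℂ → ℂ, AnalyticAt ℂ q p ∧ q p ≠ 0 ∧
      (∀ᶠ w in 𝓝 p, deflection γ m z w - deflection γ m z p = (w - p) ^ (e + 1) * q w) ∧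
      (e = 0 → q p = deriv (deflection γ m z) p) := by
  have hR := analyticAt_deflection γ m hp
  have hf : AnalyticAt ℂ (fun w => deflection γ m z w - deflection γ m z p) p :=
    hR.fun_sub analyticAt_const
  have hder : ∀ k, iteratedDeriv (k + 1) (fun w => deflection γ m z w - deflection γ m z p) p
      = iteratedDeriv (k + 1) (deflection γ m z) p := fun k => by
    simp [iteratedDeriv_succ']
  have h1 : ((e + 1 : ℕ) : ℕ∞) ≤
      analyticOrderAt (fun w => deflection γ m z w - deflection γ m z p) p := by
    rw [natCast_le_analyticOrderAt_iff_iteratedDeriv_eq_zero hf]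
    rintro (_ | k) hk
    · simp
    · rw [hder]
      exact h _ (by omega) (by omega)
  have h2 : ¬ ((e + 2 : ℕ) : ℕ∞) ≤
      analyticOrderAt (fun w => deflection γ m z w - deflection γ m z p) p := by
    rw [natCast_le_analyticOrderAt_iff_iteratedDeriv_eq_zero hf]
    intro h3
    exact hne (by rw [← hder]; exact h3 _ (by omega))
  have h3 : analyticOrderAt (fun w => deflection γ m z w - deflection γ m z p) p
      = ((e + 1 : ℕ) : ℕ∞) := by
    refine le_antisymm ?_ h1
    exact Order.le_of_lt_add_one (by exact_mod_cast not_le.1 h2)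
  obtain ⟨q, hq, hq0, hfac⟩ := hf.analyticOrderAt_eq_natCast.1 h3
  simp only [smul_eq_mul] at hfac
  refine ⟨q, hq, hq0, hfac, ?_⟩
  rintro rfl
  have h4 : HasDerivAt (fun w => (w - p) ^ (0 + 1) * q w) (q p) p := by
    simpa using ((hasDerivAt_id p).sub_const p).fun_mul hq.differentiableAt.hasDerivAt
  have h5 := (h4.congr_of_eventuallyEq hfac).deriv
  rw [← h5, deriv_sub_const]

/-! ### The rescaled equation and its limit -/

/-- Reality of `v^(e+2) c` restricts `v` to `2(e+2)` rays, indexed by `k`, on which it has sign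
`(-1)^k`; the other equation then fixes `|v|`. The factor `0 ^ e` is the limit of `t ^ e`, so `c`
affects `|v|` only if `e = 0`. -/
theorem exists_finset_rescaled_solutions (e : ℕ) {c : ℂ} (hc : c ≠ 0) (K : Finset ℕ)
    (hK : ∀ k ∈ K, k < 2 * (e + 2)) (hpos : ∀ k ∈ K, 0 < 1 - 0 ^ e * (-1) ^ k * ‖c‖) :
    ∃ T : Finset ℂ, T.card = K.card ∧ ∀ v ∈ T,
      v * conj v = 1 + 0 ^ e * (v ^ (e + 2) * c) ∧ (v ^ (e + 2) * c).im = 0 ∧ v ≠ 0 := by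
  have hcn : (‖c‖ : ℂ) ≠ 0 := by simpa using hc
  -- The rotation `α` makes `α^(e+2) c` positive; the powers of `ξ` below run through the rays.
  obtain ⟨α, hα⟩ := IsAlgClosed.exists_pow_nat_eq (conj c / ‖c‖) (n := e + 2) (by omega)
  have hα1 : ‖α‖ = 1 := by
    have : ‖α‖ ^ (e + 2) = 1 := by
      rw [← norm_pow, hα, norm_div, Complex.norm_conj, Complex.norm_real, norm_norm,
        div_self (norm_ne_zero_iff.2 hc)]
    exact (pow_eq_one_iff_of_nonneg (norm_nonneg _) (by omega)).1 this
  have hαc : α ^ (e + 2) * c = ‖c‖ := by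
    rw [hα, div_mul_eq_mul_div, Complex.conj_mul']
    field_simp
  obtain ⟨ξ, hξ⟩ : ∃ ξ : ℂ, IsPrimitiveRoot ξ (2 * (e + 2)) :=
    ⟨_, Complex.isPrimitiveRoot_exp _ (by omega)⟩
  have hξ1 : ‖ξ‖ = 1 := hξ.norm'_eq_one (by omega)
  have hξd : ξ ^ (e + 2) = -1 := by
    have h1 : (ξ ^ (e + 2)) ^ 2 = 1 := by rw [← pow_mul, mul_comm, hξ.pow_eq_one]
    exact (mul_self_eq_one_iff.1 (by rwa [← pow_two])).resolve_left
      (hξ.pow_ne_one_of_pos_of_lt (by omega) (by omega))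
  let ρ : ℕ → ℝ := fun k => (√(1 - 0 ^ e * (-1) ^ k * ‖c‖))⁻¹
  let v : ℕ → ℂ := fun k => ρ k * α * ξ ^ k
  have hρ : ∀ k ∈ K, 0 < ρ k := fun k hk => inv_pos.2 (Real.sqrt_pos.2 (hpos k hk))
  have hvn : ∀ k ∈ K, ‖v k‖ = ρ k := fun k hk => by
    simp [v, hα1, hξ1, abs_of_pos (hρ k hk)]
  have hvc : ∀ k, v k ^ (e + 2) * c = ((ρ k ^ (e + 2) * (-1) ^ k * ‖c‖ : ℝ) : ℂ) := fun k => by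
    have : v k ^ (e + 2) * c = (ρ k : ℂ) ^ (e + 2) * (ξ ^ (e + 2)) ^ k * (α ^ (e + 2) * c) := by
      simp only [v]; ring
    rw [this, hξd, hαc]
    push_cast
    ring
  have hinj : Set.InjOn v K := by
    intro k hk l hl hkl
    have h1 : ρ k = ρ l := by rw [← hvn k hk, ← hvn l hl, hkl]
    have h2 : (ρ l : ℂ) * α ≠ 0 := mul_ne_zero (Complex.ofReal_ne_zero.2 (hρ l hl).ne')
      (norm_ne_zero_iff.1 (by rw [hα1]; exact one_ne_zero))
    simp only [v, h1] at hkl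
    exact hξ.pow_inj (hK k hk) (hK l hl) (mul_left_cancel₀ h2 hkl)
  classical
  refine ⟨K.image v, Finset.card_image_of_injOn hinj, ?_⟩
  intro w hw
  obtain ⟨k, hk, rfl⟩ := Finset.mem_image.1 hw
  refine ⟨?_, ?_, ?_⟩
  · rw [hvc, Complex.mul_conj, Complex.normSq_eq_norm_sq, hvn k hk]
    have : ρ k ^ 2 = 1 + 0 ^ e * (ρ k ^ (e + 2) * (-1) ^ k * ‖c‖) := by
      rcases Nat.eq_zero_or_pos e with rfl | he
      · have h1 := hpos k hk
        have h2 : ρ k ^ 2 * (1 - 0 ^ 0 * (-1) ^ k * ‖c‖) = 1 := by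
          simp only [ρ]
          rw [inv_pow, Real.sq_sqrt h1.le, inv_mul_cancel₀ h1.ne']
        linear_combination h2
      · simp [ρ, he.ne']
    rw [this]
    push_cast
    ring
  · rw [hvc, Complex.ofReal_im]
  · exact norm_ne_zero_iff.1 (by rw [hvn k hk]; exact (hρ k hk).ne')

theorem eq_zero_of_ofReal_add_I_mul_eq_zero {a b : ℝ} (h : (a : ℂ) + Complex.I * (b : ℂ) = 0) :
    a = 0 ∧ b = 0 := by
  simpa [Complex.ext_iff] using h

/-- The equation for the images near an image `p`, after rescaling by the square root `t` of the
added mass; the function `q` is the leading factor of the deflection at `p`. -/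
noncomputable def rescaledEquation (e : ℕ) (q : ℂ → ℂ) (p : ℂ) (x : ℝ × ℂ) : ℂ :=
  x.2 * conj x.2 - 1
    - ((x.1 ^ e * (x.2 ^ (e + 2) * q (p + x.1 * x.2)).re : ℝ) : ℂ)
    + Complex.I * ((x.2 ^ (e + 2) * q (p + x.1 * x.2)).im : ℂ)

theorem contDiffAt_rescaledEquation (e : ℕ) {q : ℂ → ℂ} {p : ℂ} (hq : AnalyticAt ℂ q p) (v : ℂ) :
    ContDiffAt ℝ 1 (rescaledEquation e q p) (0, v) := by
  have h1 : ContDiffAt ℝ 1 q (p + (((0 : ℝ), v).1 : ℂ) * ((0 : ℝ), v).2) := by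
    simpa using (hq.contDiffAt (n := 1)).restrict_scalars ℝ
  have hfst : ContDiff ℝ 1 (fun x : ℝ × ℂ => (x.1 : ℂ)) :=
    Complex.ofRealCLM.contDiff.comp contDiff_fst
  have h2 : ContDiffAt ℝ 1 (fun x : ℝ × ℂ => p + (x.1 : ℂ) * x.2) (0, v) :=
    (contDiff_const.add (hfst.mul contDiff_snd)).contDiffAt
  have h3 : ContDiffAt ℝ 1 (fun x : ℝ × ℂ => x.2 ^ (e + 2) * q (p + x.1 * x.2)) (0, v) :=
    (contDiff_snd.pow _).contDiffAt.mul
      (ContDiffAt.comp (g := q) (f := fun x : ℝ × ℂ => p + (x.1 : ℂ) * x.2) ((0 : ℝ), v) h1 h2)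
  have hre := Complex.reCLM.contDiff.contDiffAt.comp ((0 : ℝ), v) h3
  have him := Complex.imCLM.contDiff.contDiffAt.comp ((0 : ℝ), v) h3
  unfold rescaledEquation
  refine (((contDiffAt_snd.mul (contDiff_conj.comp contDiff_snd).contDiffAt).sub
    contDiffAt_const).sub ?_).add (contDiffAt_const.mul ?_)
  · exact Complex.ofRealCLM.contDiff.contDiffAt.comp ((0 : ℝ), v)
      (((contDiff_fst.pow e).contDiffAt).mul hre)
  · exact Complex.ofRealCLM.contDiff.contDiffAt.comp ((0 : ℝ), v) him

/-- Put `w = v u`. As `v^(e+2) q(p)` is a real `k ≠ 0`, the derivative is diagonal in `(Re u, Im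
u)`. Its entries are `2`, by `|v|² = 1 + 0^e k` and `0^e e = 0`, and `(e+2) k`. -/
theorem exists_hasFDerivAt_rescaledEquation_injective (e : ℕ) {q : ℂ → ℂ} {p v : ℂ}
    (hq : q p ≠ 0) (hv : v ≠ 0) (hre : v * conj v = 1 + 0 ^ e * (v ^ (e + 2) * q p))
    (him : (v ^ (e + 2) * q p).im = 0) :
    ∃ L : ℂ →L[ℝ] ℂ, HasFDerivAt (fun w => rescaledEquation e q p (0, w)) L v ∧
      ∀ w, L w = 0 → w = 0 := by
  have hg : HasDerivAt (fun w : ℂ => w ^ (e + 2) * q p)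
      (((e + 2 : ℕ) : ℂ) * v ^ (e + 1) * q p) v := by
    simpa using (hasDerivAt_pow (e + 2) v).mul_const (q p)
  have hG := hg.hasFDerivAt.restrictScalars ℝ
  have hGre := Complex.reCLM.hasFDerivAt.comp v hG
  have hGim := Complex.imCLM.hasFDerivAt.comp v hG
  have hconj : HasFDerivAt (fun w : ℂ => conj w) (Complex.conjCLE : ℂ →L[ℝ] ℂ) v :=
    (Complex.conjCLE : ℂ →L[ℝ] ℂ).hasFDerivAt
  have hD := ((((hasFDerivAt_id v).fun_mul hconj).sub_const 1).sub
    (Complex.ofRealCLM.hasFDerivAt.comp v (hGre.const_mul ((0 : ℝ) ^ e)))).add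
    ((Complex.ofRealCLM.hasFDerivAt.comp v hGim).const_mul Complex.I)
  refine ⟨_, hD.congr_of_eventuallyEq (.of_forall fun w => ?_), ?_⟩
  · simp [rescaledEquation]
  intro w hw
  obtain ⟨u, rfl⟩ : ∃ u, w = v * u := ⟨w / v, by field_simp⟩
  set k : ℝ := (v ^ (e + 2) * q p).re with hk
  have hkv : v ^ (e + 2) * q p = k := Complex.ext rfl (by simpa using him)
  have hk0 : k ≠ 0 := by
    intro h
    rw [h, Complex.ofReal_zero] at hkv
    exact mul_ne_zero (pow_ne_zero _ hv) hq hkv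
  have hderiv : v * u * (((e + 2 : ℕ) : ℂ) * v ^ (e + 1) * q p)
      = (((e + 2 : ℕ) * k : ℝ) : ℂ) * u := by
    push_cast
    rw [← hkv]
    ring
  have hN : (v * conj v) = ((1 + 0 ^ e * k : ℝ) : ℂ) := by
    rw [hre, hkv]; push_cast; rfl
  have hee : (0 : ℝ) ^ e * e = 0 := by rcases e with _ | e <;> simp
  have hw' : v * conj v * (2 * (u.re : ℂ))
      - ((0 ^ e * ((((e + 2 : ℕ) * k : ℝ) : ℂ) * u).re : ℝ) : ℂ)
      + Complex.I * (((((e + 2 : ℕ) * k : ℝ) : ℂ) * u).im : ℂ) = 0 := by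
    rw [← hderiv, ← Complex.ofReal_ofNat, ← hw]
    have := Complex.add_conj u
    push_cast at this
    simp
    linear_combination (-(v * conj v)) * this
  rw [hN, Complex.re_ofReal_mul, Complex.im_ofReal_mul] at hw'
  obtain ⟨h1, h2⟩ := eq_zero_of_ofReal_add_I_mul_eq_zero
    (a := (1 + 0 ^ e * k) * (2 * u.re) - 0 ^ e * ((e + 2 : ℕ) * k * u.re))
    (b := (e + 2 : ℕ) * k * u.im) (by push_cast at hw' ⊢; linear_combination hw')
  have hu1 : u.re = 0 := by
    push_cast at h1
    linear_combination h1 / 2 + hee * k * u.re / 2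
  have hu2 : u.im = 0 :=
    (mul_eq_zero.1 h2).resolve_left (mul_ne_zero (by positivity) hk0)
  have : u = 0 := Complex.ext hu1 hu2
  simp [this]

theorem rescaledEquation_ne_zero_zero (e : ℕ) (q : ℂ → ℂ) (p : ℂ) (t : ℝ) :
    rescaledEquation e q p (t, 0) ≠ 0 := by
  simp [rescaledEquation]

/-- A solution of the rescaled equation gives an image. -/
theorem mem_images_of_rescaledEquation {n : ℕ} {γ : ℂ} {m : Fin n → ℝ} {z : Fin n → ℂ} {p ζ : ℂ}
    (hp : p ∈ images γ m z ζ) {e : ℕ} {q : ℂ → ℂ} {t : ℝ} (ht : t ≠ 0) {v : ℂ}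
    (hz : p + t * v ∈ lensPlane z)
    (hfac : deflection γ m z (p + t * v) - deflection γ m z p
      = (t * v) ^ (e + 1) * q (p + t * v))
    (h : rescaledEquation e q p (t, v) = 0) :
    p + t * v ∈ images γ (addMass m (t ^ 2)) (addPosition z p) ζ := by
  have htc : (t : ℂ) ≠ 0 := Complex.ofReal_ne_zero.2 ht
  have hv : v ≠ 0 := by
    rintro rfl
    exact rescaledEquation_ne_zero_zero e q p t h
  have hwp : p + t * v ≠ p := by simp [hv, ht]
  refine mem_images_add.2 ⟨hz, hwp, ?_⟩
  set g := v ^ (e + 2) * q (p + t * v) with hg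
  have hunf : v * conj v - 1 - ((t ^ e * g.re : ℝ) : ℂ) + Complex.I * (g.im : ℂ) = 0 := h
  have him : g.im = 0 :=
    (eq_zero_of_ofReal_add_I_mul_eq_zero (a := Complex.normSq v - 1 - t ^ e * g.re) (by
      rw [← hunf, Complex.mul_conj]; push_cast; ring)).2
  have hgre : g = g.re := Complex.ext rfl (by simpa using him)
  have hre : v * conj v - 1 = (t : ℂ) ^ e * g := by
    rw [him] at hunf
    push_cast at hunf
    rw [← hgre] at hunf
    linear_combination hunf
  rw [lensMap_eq_sub_conj_deflection, ← hp.2, lensMap_eq_sub_conj_deflection]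
  -- The conjugated equation contains the deflection itself, so the factorization applies directly.
  have key : conj (p + t * v) - deflection γ m z (p + t * v) - ((t ^ 2 : ℝ) : ℂ) / (p + t * v - p)
      - (conj p - deflection γ m z p) = 0 := by
    have h1 : conj (p + t * v) = conj p + t * conj v := by simp
    rw [h1, add_sub_cancel_left]
    push_cast
    field_simp
    linear_combination (-v) * hfac + t * hre + t * t ^ e * hg
  have := congrArg conj key
  simpa using this

theorem eventually_exists_image_of_rescaledEquation {n : ℕ} {γ : ℂ} {m : Fin n → ℝ}
    {z : Fin n → ℂ} {p ζ : ℂ} (hp : p ∈ images γ m z ζ) {e : ℕ} {q : ℂ → ℂ}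
    (hq : AnalyticAt ℂ q p) (hq0 : q p ≠ 0)
    (hfac : ∀ᶠ w in 𝓝 p,
      deflection γ m z w - deflection γ m z p = (w - p) ^ (e + 1) * q w)
    {v : ℂ} (hv : v ≠ 0) (hre : v * conj v = 1 + 0 ^ e * (v ^ (e + 2) * q p))
    (him : (v ^ (e + 2) * q p).im = 0) {U : Set ℂ} (hU : U ∈ 𝓝 v) {r : ℝ} (hr : 0 < r) :
    ∀ᶠ t in 𝓝[>] (0 : ℝ), ∃ w ∈ U,
      p + t * w ∈ images γ (addMass m (t ^ 2)) (addPosition z p) ζ ∩ Metric.ball p r := by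
  have hN : {w | w ∈ lensPlane z ∧ w ∈ Metric.ball p r ∧
      deflection γ m z w - deflection γ m z p = (w - p) ^ (e + 1) * q w} ∈ 𝓝 p := by
    filter_upwards [(isOpen_lensPlane z).mem_nhds hp.1, Metric.ball_mem_nhds p hr, hfac]
      with w h1 h2 h3 using ⟨h1, h2, h3⟩
  have hlim : Tendsto (fun x : ℝ × ℂ => p + (x.1 : ℂ) * x.2) (𝓝 (0, v)) (𝓝 p) :=
    (by fun_prop : Continuous fun x : ℝ × ℂ => p + (x.1 : ℂ) * x.2).tendsto' _ _ (by simp)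
  obtain ⟨A, hA, B, hB, hAB⟩ := mem_nhds_prod_iff.1 (hlim hN)
  obtain ⟨L, hL, hinj⟩ := exists_hasFDerivAt_rescaledEquation_injective e hq0 hv hre him
  have h0 : rescaledEquation e q p (0, v) = 0 := by
    have h1 : v ^ (e + 2) * q p = ((v ^ (e + 2) * q p).re : ℂ) :=
      Complex.ext rfl (by simpa using him)
    rw [h1] at hre
    simp only [rescaledEquation, Complex.ofReal_zero, zero_mul, add_zero, him, mul_zero]
    rw [hre]
    push_cast
    ring
  filter_upwards [nhdsWithin_le_nhds (eventually_exists_zero (contDiffAt_rescaledEquation e hq v)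
    h0 hL hinj (inter_mem hU hB)), nhdsWithin_le_nhds hA, self_mem_nhdsWithin]
    with t ⟨w, hw, h⟩ htA ht
  obtain ⟨h1, h2, h3⟩ := hAB (Set.mk_mem_prod htA hw.2)
  refine ⟨w, hw.1, mem_images_of_rescaledEquation hp (ne_of_gt ht) h1 ?_ h, h2⟩
  simpa using h3

theorem eventually_card_le_encard {n : ℕ} {γ : ℂ} {m : Fin n → ℝ}
    {z : Fin n → ℂ} {p ζ : ℂ} (hp : p ∈ images γ m z ζ) {e : ℕ} {q : ℂ → ℂ}
    (hq : AnalyticAt ℂ q p) (hq0 : q p ≠ 0)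
    (hfac : ∀ᶠ w in 𝓝 p,
      deflection γ m z w - deflection γ m z p = (w - p) ^ (e + 1) * q w)
    (K : Finset ℕ) (hK : ∀ k ∈ K, k < 2 * (e + 2))
    (hpos : ∀ k ∈ K, 0 < 1 - 0 ^ e * (-1) ^ k * ‖q p‖) {r : ℝ} (hr : 0 < r) :
    ∀ᶠ μ in 𝓝[>] (0 : ℝ), (K.card : ℕ∞) ≤
      (images γ (addMass m μ) (addPosition z p) ζ ∩ Metric.ball p r).encard := by
  obtain ⟨T, hTK, hT⟩ := exists_finset_rescaled_solutions e hq0 K hK hpos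
  obtain ⟨U, hU, hUd⟩ := T.finite_toSet.t2_separation
  have hev : ∀ᶠ t in 𝓝[>] (0 : ℝ), ∀ v ∈ (T : Set ℂ), ∃ w ∈ U v,
      p + t * w ∈ images γ (addMass m (t ^ 2)) (addPosition z p) ζ ∩ Metric.ball p r :=
    (eventually_all_finite T.finite_toSet).2 fun v hv =>
      eventually_exists_image_of_rescaledEquation hp hq hq0 hfac (hT v hv).2.2 (hT v hv).1
        (hT v hv).2.1 ((hU v).2.mem_nhds (hU v).1) hr
  have hsqrt : Tendsto Real.sqrt (𝓝[>] 0) (𝓝[>] 0) := by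
    refine tendsto_nhdsWithin_iff.2 ⟨?_, ?_⟩
    · exact (Real.continuous_sqrt.tendsto' 0 0 Real.sqrt_zero).mono_left nhdsWithin_le_nhds
    · filter_upwards [self_mem_nhdsWithin] with μ hμ using Real.sqrt_pos.2 hμ
  filter_upwards [hsqrt.eventually hev, self_mem_nhdsWithin] with μ h hμ
  rw [Real.sq_sqrt (le_of_lt hμ)] at h
  choose! g hgU hg using h
  have hinj : Set.InjOn (fun v => p + (√μ : ℂ) * g v) (T : Set ℂ) := by
    intro a ha b hb hab
    have hs : (√μ : ℂ) ≠ 0 := Complex.ofReal_ne_zero.2 (Real.sqrt_pos.2 hμ).ne'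
    have hgab : g a = g b := mul_left_cancel₀ hs (add_left_cancel hab)
    by_contra hne
    exact Set.disjoint_left.1 (hUd ha hb hne) (hgU a ha) (hgab ▸ hgU b hb)
  rw [← hTK, ← Set.encard_coe_eq_coe_finsetCard, ← hinj.encard_image]
  refine Set.encard_le_encard ?_
  rintro _ ⟨v, hv, rfl⟩
  exact hg v hv

/-! ### Counting images in the disk -/

theorem eventually_two_le_encard {n : ℕ} {γ : ℂ} {m : Fin n → ℝ} {z : Fin n → ℂ} {p ζ : ℂ}
    (hp : IsSenseReversingImage γ m z ζ p) {r : ℝ} (hr : 0 < r) :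
    ∀ᶠ μ in 𝓝[>] (0 : ℝ),
      2 ≤ (images γ (addMass m μ) (addPosition z p) ζ ∩ Metric.ball p r).encard := by
  have hne : iteratedDeriv (0 + 1) (deflection γ m z) p ≠ 0 := by
    rw [zero_add, iteratedDeriv_one]
    exact norm_pos_iff.1 (one_pos.trans hp.2)
  obtain ⟨q, hq, hq0, hfac, hqd⟩ := exists_deflection_factorization γ m hp.1.1
    (fun k h1 h2 => by omega) hne
  -- Only odd `k` are used: there the condition is `0 < 1 + ‖q p‖`, while for even `k` it fails when
  -- `‖q p‖ > 1`.
  refine eventually_card_le_encard hp.1 hq hq0 hfac {1, 3} (by simp) ?_ hr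
  have := norm_nonneg (q p)
  intro k hk
  rcases Finset.mem_insert.1 hk with rfl | hk
  · norm_num; linarith
  · rw [Finset.mem_singleton.1 hk]
    norm_num; linarith

theorem eventually_two_mul_le_encard {n : ℕ} {γ : ℂ} {m : Fin n → ℝ} {z : Fin n → ℂ} {p ζ : ℂ}
    (hp : IsSensePreservingImage γ m z ζ p) {e : ℕ}
    (h : ∀ k, 1 ≤ k → k ≤ e → iteratedDeriv k (deflection γ m z) p = 0)
    (hne : iteratedDeriv (e + 1) (deflection γ m z) p ≠ 0) {r : ℝ} (hr : 0 < r) :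
    ∀ᶠ μ in 𝓝[>] (0 : ℝ), ((2 * (e + 2) : ℕ) : ℕ∞) ≤
      (images γ (addMass m μ) (addPosition z p) ζ ∩ Metric.ball p r).encard := by
  obtain ⟨q, hq, hq0, hfac, hqd⟩ := exists_deflection_factorization γ m hp.1.1 h hne
  have := eventually_card_le_encard hp.1 hq hq0 hfac (Finset.range (2 * (e + 2)))
    (fun k hk => Finset.mem_range.1 hk) (fun k _ => ?_) hr
  · simpa only [Finset.card_range] using this
  · rcases Nat.eq_zero_or_pos e with rfl | he
    · have h1 : ‖q p‖ < 1 := by rw [hqd rfl]; exact hp.2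
      have := norm_nonneg (q p)
      rcases neg_one_pow_eq_or ℝ k with h2 | h2 <;> rw [h2] <;> norm_num <;> linarith
    · simp [he.ne']

/-- One threshold serves all `d`, because the vanishing conditions determine `d` uniquely. -/
theorem eventually_forall_two_mul_le_encard {n : ℕ} (γ : ℂ) (m : Fin n → ℝ) (z : Fin n → ℂ)
    (p ζ : ℂ) {r : ℝ} (hr : 0 < r) :
    ∀ᶠ μ in 𝓝[>] (0 : ℝ), ∀ d : ℕ, 2 ≤ d → IsSensePreservingImage γ m z ζ p →
      (∀ k : ℕ, 1 ≤ k → k ≤ d - 2 → iteratedDeriv k (deflection γ m z) p = 0) →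
      iteratedDeriv (d - 1) (deflection γ m z) p ≠ 0 →
      ((2 * d : ℕ) : ℕ∞) ≤
        (images γ (addMass m μ) (addPosition z p) ζ ∩ Metric.ball p r).encard := by
  by_cases hex : ∃ d : ℕ, 2 ≤ d ∧ IsSensePreservingImage γ m z ζ p ∧
      (∀ k : ℕ, 1 ≤ k → k ≤ d - 2 → iteratedDeriv k (deflection γ m z) p = 0) ∧
      iteratedDeriv (d - 1) (deflection γ m z) p ≠ 0
  · obtain ⟨d, hd, hp, hk, hne⟩ := hex
    obtain ⟨e, rfl⟩ := Nat.exists_eq_add_of_le' hd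
    filter_upwards [eventually_two_mul_le_encard hp hk hne hr] with μ hμ d' hd' _ hk' hne'
    obtain rfl : d' = e + 2 := by
      rcases lt_trichotomy d' (e + 2) with hlt | heq | hlt
      · exact absurd (hk (d' - 1) (by omega) (by omega)) hne'
      · exact heq
      · exact absurd (hk' (e + 2 - 1) (by omega) (by omega)) hne
    exact hμ
  · filter_upwards with μ d hd hp hk hne
    exact absurd ⟨d, hd, hp, hk, hne⟩ hex

end PointLens

/-! ### The main theorem -/

open PointLens Filter Topology in
theorem theorem2 (n : ℕ) (hn : 2 ≤ n) (γ : ℂ) (hγ : ‖γ‖ ≠ 1)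
    (m : Fin n → ℝ) (hm : ∀ j, 0 < m j) (z : Fin n → ℂ)
    (p : ℂ) (hp : ∀ j, p ≠ z j)
    (ζ : ℂ) (hζ : ζ ∉ PointLens.caustic γ m z) :
    ∃ μ₀ : ℝ, 0 < μ₀ ∧ ∀ μ : ℝ, 0 < μ → μ < μ₀ →
      ζ ∉ PointLens.caustic γ (PointLens.addMass m μ) (PointLens.addPosition z p) →
      ∃ r : ℝ, 0 < r ∧
        -- the punctured disk contains no mass point and no image of the first lens
        (∀ w ∈ Metric.ball p r \ {p},
          (∀ j, w ≠ z j) ∧ w ∉ PointLens.images γ m z ζ) ∧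
        -- both lenses have the same finite number of images outside the disk
        (PointLens.images γ m z ζ \ Metric.ball p r).Finite ∧
        (PointLens.images γ (PointLens.addMass m μ) (PointLens.addPosition z p) ζ
            \ Metric.ball p r).encard
          = (PointLens.images γ m z ζ \ Metric.ball p r).encard ∧
        -- the position of the added mass is not an image
        (p ∉ PointLens.images γ m z ζ →
          1 ≤ (PointLens.images γ (PointLens.addMass m μ) (PointLens.addPosition z p) ζ
            ∩ Metric.ball p r).encard) ∧
        -- it is a sense-reversing image
        (PointLens.IsSenseReversingImage γ m z ζ p →
          2 ≤ (PointLens.images γ (PointLens.addMass m μ) (PointLens.addPosition z p) ζ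
            ∩ Metric.ball p r).encard) ∧
        -- it is a sense-preserving image with non-vanishing first derivative
        (PointLens.IsSensePreservingImage γ m z ζ p →
          deriv (PointLens.deflection γ m z) p ≠ 0 →
          4 ≤ (PointLens.images γ (PointLens.addMass m μ) (PointLens.addPosition z p) ζ
            ∩ Metric.ball p r).encard) ∧
        -- it is a sense-preserving image, and the first `d - 2` derivatives vanish
        (∀ d : ℕ, 2 ≤ d →
          PointLens.IsSensePreservingImage γ m z ζ p →
          (∀ k : ℕ, 1 ≤ k → k ≤ d - 2 →
            iteratedDeriv k (PointLens.deflection γ m z) p = 0) →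
          iteratedDeriv (d - 1) (PointLens.deflection γ m z) p ≠ 0 →
          ((2 * d : ℕ) : ℕ∞)
            ≤ (PointLens.images γ (PointLens.addMass m μ) (PointLens.addPosition z p) ζ
              ∩ Metric.ball p r).encard) := by
  have hpz : p ∈ lensPlane z := hp
  have hnear : ∀ᶠ w in 𝓝 p, w ∈ lensPlane z ∧ (w ≠ p → w ∉ images γ m z ζ) :=
    ((isOpen_lensPlane z).eventually_mem hpz).and
      (eventually_nhdsWithin_iff.1 (eventually_notMem_images hζ hpz))
  obtain ⟨r, hr, hrball⟩ := Metric.nhds_basis_closedBall.eventually_iff.1 hnear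
  have hall : ∀ᶠ μ in 𝓝[>] (0 : ℝ),
      (images γ (addMass m μ) (addPosition z p) ζ \ Metric.ball p r).encard
        = (images γ m z ζ \ Metric.ball p r).encard ∧
      (p ∉ images γ m z ζ →
        1 ≤ (images γ (addMass m μ) (addPosition z p) ζ ∩ Metric.ball p r).encard) ∧
      (IsSenseReversingImage γ m z ζ p →
        2 ≤ (images γ (addMass m μ) (addPosition z p) ζ ∩ Metric.ball p r).encard) ∧
      (∀ d : ℕ, 2 ≤ d → IsSensePreservingImage γ m z ζ p →
        (∀ k : ℕ, 1 ≤ k → k ≤ d - 2 → iteratedDeriv k (deflection γ m z) p = 0) →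
        iteratedDeriv (d - 1) (deflection γ m z) p ≠ 0 →
        ((2 * d : ℕ) : ℕ∞) ≤
          (images γ (addMass m μ) (addPosition z p) ζ ∩ Metric.ball p r).encard) := by
    refine (eventually_encard_images_diff_ball hγ hm hζ hr
      fun w hw => (hrball hw.1).2 hw.2).and (Eventually.and ?_ (Eventually.and ?_
        (eventually_forall_two_mul_le_encard γ m z p ζ hr)))
    · exact eventually_imp_distrib_left.2 fun h => eventually_one_le_encard γ m hpz h hr
    · exact eventually_imp_distrib_left.2 fun h => eventually_two_le_encard h hr
  obtain ⟨μ₀, hμ₀, hμ⟩ := mem_nhdsGT_iff_exists_Ioo_subset.1 hall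
  refine ⟨μ₀, hμ₀, fun μ h1 h2 _ => ⟨r, hr, ?_, (finite_images hγ hm hζ).sdiff, ?_⟩⟩
  · intro w hw
    have := hrball (Metric.ball_subset_closedBall hw.1)
    exact ⟨this.1, this.2 hw.2⟩
  · obtain ⟨hout, hone, htwo, hd⟩ := hμ ⟨h1, h2⟩
    refine ⟨hout, hone, htwo, fun hs hne => ?_, hd⟩
    -- This is the case `d = 2`, where no derivative is required to vanish.
    exact hd 2 le_rfl hs (fun k hk1 hk2 => by omega) (by simpa using hne)
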